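/- A $D_4$-quartic field of signature $(2,1)$ is a number field $L$ of degree $4$ over $\mathbb{Q}$ with exactly two real embeddings $\sigma_1,\sigma_2$ and one pair of complex conjugate embeddings $\tau,\overline{\tau}$, whose Galois closure has Galois group over $\mathbb{Q}$ isomorphic to the dihedral group $D_4$ of order $8$. Its unit lattice $E_L$ is the image of $\mathcal{O}_L^\times$ under $$u\mapsto(\log|\sigma_1(u)|,\ \log|\sigma_2(u)|,\ 2\log|\tau(u)|)\in\mathbb{R}^3$$ with the Euclidean length of $\mathbb{R}^3$; it is a lattice of rank $2$. Let $$\mathscr{F}=\{x+iy : 0\le x\le \tfrac12,\ y>0,\ x^2+y^2\ge 1\}$$ be the standard fundamental domain of $\mathrm{GL}_2(\mathbb{Z})$ acting on the upper half plane. The unit shape $p_L$ of $L$ is the unique point $z\in\mathscr{F}$ such that the lattices $\mathbb{Z}+\mathbb{Z}z\subset\mathbb{C}$ and $E_L$ agree up to scaling, rotation and reflection. Let $K$ be a real quadratic field, and let $\mathscr{F}(K)$ be the set of isomorphism classes of $D_4$-quartic fields $L$ of signature $(2,1)$ that contain $K$ as a subfield. Then only finitely many points of the set $\{p_L : L\in\mathscr{F}(K)\}$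 lie on the lower arc $$\{x+iy : x^2+y^2=1,\ 0\le x\le\tfrac12,\ y>0\}$$ of the boundary of $\mathscr{F}$. -/

import Mathlib

open NumberField UpperHalfPlane

namespace UnitShape

/-- The logarithmic embedding of the units of `L` into `ℝ ^ (r + s)` with its Euclidean norm: the
coordinate at a real place `σ` is `log |σ u|` and the one at a complex place `τ` is
`2 * log |τ u|`. -/
noncomputable def logEmb (L : Type*) [Field L] [NumberField L] :
    Additive (𝓞 L)ˣ →+ EuclideanSpace ℝ (InfinitePlace L) where
  toFun u := WithLp.toLp 2 fun w => (w.mult : ℝ) * Real.log (w (u.toMul : L))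
  map_zero' := by
    ext w
    simp
  map_add' u v := by
    ext w
    have hu : w ((u.toMul : (𝓞 L)ˣ) : L) ≠ 0 := by simp
    have hv : w ((v.toMul : (𝓞 L)ˣ) : L) ≠ 0 := by simp
    simp [Real.log_mul, mul_add]

/-- The unit lattice `E_L`: the units modulo torsion, realised as the image of the logarithmic
embedding, with the Euclidean length of the ambient space. -/
noncomputable def unitLattice (L : Type*) [Field L] [NumberField L] :
    AddSubgroup (EuclideanSpace ℝ (InfinitePlace L)) :=
  (logEmb L).range

/-- The lattice `ℤ + ℤ z` in the complex plane. -/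
noncomputable def planeLattice (z : ℍ) : AddSubgroup ℂ :=
  AddSubgroup.closure {1, (z : ℂ)}

/-- Two lattices have the same shape when they are the same up to scaling, rotation and reflection:
there is a group isomorphism between them that multiplies all lengths by one positive constant. -/
def SameShape {V W : Type*} [NormedAddCommGroup V] [NormedAddCommGroup W]
    (A : AddSubgroup V) (B : AddSubgroup W) : Prop :=
  ∃ (e : A ≃+ B) (c : ℝ), 0 < c ∧ ∀ x : A, ‖(e x : W)‖ = c * ‖(x : V)‖

/-- The standard fundamental domain of `GL₂(ℤ)` acting on the upper half plane. -/
def fundamentalDomain : Set ℍ :=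
  {z | 0 ≤ z.re ∧ z.re ≤ 1 / 2 ∧ 1 ≤ z.re ^ 2 + z.im ^ 2}

/-- The lower arc of the boundary of the fundamental domain. -/
def lowerArc : Set ℍ :=
  {z | 0 ≤ z.re ∧ z.re ≤ 1 / 2 ∧ z.re ^ 2 + z.im ^ 2 = 1}

/-- `z` is the point `p_L`: the point of the fundamental domain that represents the unit lattice
of `L` up to scaling, rotation and reflection. -/
def IsUnitShape (L : Type*) [Field L] [NumberField L] (z : ℍ) : Prop :=
  z ∈ fundamentalDomain ∧ SameShape (planeLattice z) (unitLattice L)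

theorem SameShape.trans {U V W : Type*} [NormedAddCommGroup U] [NormedAddCommGroup V]
    [NormedAddCommGroup W] {A : AddSubgroup U} {B : AddSubgroup V} {C : AddSubgroup W}
    (h : SameShape A B) (h' : SameShape B C) : SameShape A C := by
  obtain ⟨e, c, hc, he⟩ := h
  obtain ⟨e', c', hc', he'⟩ := h'
  refine ⟨e.trans e', c' * c, by positivity, fun x => ?_⟩
  simp [he', he, mul_assoc]

theorem SameShape.symm {V W : Type*} [NormedAddCommGroup V] [NormedAddCommGroup W]
    {A : AddSubgroup V} {B : AddSubgroup W} (h : SameShape A B) : SameShape B A := by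
  obtain ⟨e, c, hc, he⟩ := h
  refine ⟨e.symm, c⁻¹, by positivity, fun x => ?_⟩
  have := he (e.symm x)
  rw [e.apply_symm_apply] at this
  rw [this, inv_mul_cancel_left₀ hc.ne']

theorem sameShape_map {V W : Type*} [NormedAddCommGroup V] [NormedAddCommGroup W]
    (f : V →+ W) (c : ℝ) (hc : 0 < c) (hf : ∀ x, ‖f x‖ = c * ‖x‖) (A : AddSubgroup V) :
    SameShape A (A.map f) := by
  have hinj : Function.Injective f := by
    rw [injective_iff_map_eq_zero]
    intro x hx
    have := hf x
    rw [hx, norm_zero] at this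
    have h2 : ‖x‖ = 0 := by
      rcases mul_eq_zero.1 this.symm with h | h
      · exact absurd h hc.ne'
      · exact h
    exact norm_eq_zero.1 h2
  exact ⟨A.equivMapOfInjective f hinj, c, hc, fun x => by simp [hf]⟩

theorem mem_planeLattice {z : ℍ} {x : ℂ} :
    x ∈ planeLattice z ↔ ∃ m n : ℤ, x = m * z + n := by
  rw [planeLattice, AddSubgroup.mem_closure_pair]
  simp only [zsmul_eq_mul, mul_one]
  exact ⟨fun ⟨a, b, h⟩ => ⟨b, a, by rw [← h, add_comm]⟩,
    fun ⟨a, b, h⟩ => ⟨b, a, by rw [h, add_comm]⟩⟩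

theorem norm_sq_comb (z : ℍ) (m n : ℤ) :
    ‖(m * z + n : ℂ)‖ ^ 2 =
      m ^ 2 * (z.re ^ 2 + z.im ^ 2) + 2 * (m * n) * z.re + n ^ 2 := by
  rw [Complex.sq_norm, Complex.normSq_apply]
  simp
  ring

theorem norm_sq_comb_ge {z : ℍ} (hz : z ∈ fundamentalDomain) (m n : ℤ) :
    (m ^ 2 * (z.re ^ 2 + z.im ^ 2) - |(m * n : ℝ)| + n ^ 2 : ℝ) ≤ ‖(m * z + n : ℂ)‖ ^ 2 := by
  rw [norm_sq_comb]
  obtain ⟨h0, h1, h2⟩ := hz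
  have := neg_abs_le (m * n : ℝ)
  have h3 := abs_nonneg (m * n : ℝ)
  nlinarith

theorem one_le_comb {m n : ℤ} (h : m ≠ 0 ∨ n ≠ 0) : (1 : ℝ) ≤ m ^ 2 - |(m * n : ℝ)| + n ^ 2 := by
  have : (1 : ℤ) ≤ m ^ 2 - |m * n| + n ^ 2 := by
    have h1 : 0 < m ^ 2 + n ^ 2 := by
      rcases h with h | h <;> positivity
    rcases abs_cases (m * n) with ⟨h2, _⟩ | ⟨h2, _⟩ <;> rw [h2] <;>
      nlinarith [sq_nonneg (m - n), sq_nonneg (m + n)]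
  exact_mod_cast this

theorem one_le_norm {z : ℍ} (hz : z ∈ fundamentalDomain) {x : ℂ} (hx : x ∈ planeLattice z)
    (h0 : x ≠ 0) : 1 ≤ ‖x‖ := by
  obtain ⟨m, n, rfl⟩ := mem_planeLattice.1 hx
  have h : m ≠ 0 ∨ n ≠ 0 := by
    by_contra! h
    simp [h.1, h.2] at h0
  have h1 := norm_sq_comb_ge hz m n
  have h2 := one_le_comb h
  have h3 := hz.2.2
  have h4 := sq_nonneg (m : ℝ)
  have : 1 ≤ ‖(m * z + n : ℂ)‖ ^ 2 := by nlinarith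
  exact (one_le_sq_iff₀ (norm_nonneg _)).1 this

theorem norm_le_norm_comb {z : ℍ} (hz : z ∈ fundamentalDomain) {m n : ℤ} (hm : m ≠ 0) :
    z.re ^ 2 + z.im ^ 2 ≤ ‖(m * z + n : ℂ)‖ ^ 2 := by
  have h1 := norm_sq_comb_ge hz m n
  have h2 := one_le_comb (n := n) (Or.inl hm)
  have h3 := hz.2.2
  have h4 : (1 : ℝ) ≤ m ^ 2 := by
    have : (1 : ℤ) ≤ m ^ 2 := by
      have : 0 < m ^ 2 := by positivity
      omega
    exact_mod_cast this
  nlinarith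

theorem le_of_sameShape {z w : ℍ} (hz : z ∈ fundamentalDomain) (hw : w ∈ fundamentalDomain)
    (h : SameShape (planeLattice z) (planeLattice w)) :
    w.re ^ 2 + w.im ^ 2 ≤ z.re ^ 2 + z.im ^ 2 ∧ w.im ^ 2 ≤ z.im ^ 2 := by
  obtain ⟨e, c, hc, he⟩ := h
  have hone : (1 : ℂ) ∈ planeLattice z := mem_planeLattice.2 ⟨0, 1, by simp⟩
  have hzz : (z : ℂ) ∈ planeLattice z := mem_planeLattice.2 ⟨1, 0, by simp⟩
  have hone' : (1 : ℂ) ∈ planeLattice w := mem_planeLattice.2 ⟨0, 1, by simp⟩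
  have hc1 : c = 1 := by
    apply le_antisymm
    · have h1 := he (e.symm ⟨1, hone'⟩)
      rw [e.apply_symm_apply] at h1
      simp only [norm_one] at h1
      have h2 : ((e.symm ⟨1, hone'⟩ : planeLattice z) : ℂ) ≠ 0 := by
        intro h
        rw [h] at h1
        simp at h1
      have h3 := one_le_norm hz (e.symm ⟨1, hone'⟩).2 h2
      nlinarith
    · have h1 := he ⟨1, hone⟩
      simp only [norm_one, mul_one] at h1
      have h2 : ((e ⟨1, hone⟩ : planeLattice w) : ℂ) ≠ 0 := by
        intro h
        rw [h] at h1
        simp at h1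
        exact hc.ne h1
      rw [← h1]
      exact one_le_norm hw (e ⟨1, hone⟩).2 h2
  subst hc1
  simp only [one_mul] at he
  obtain ⟨m, n, hmn⟩ := mem_planeLattice.1 (e ⟨1, hone⟩).2
  obtain ⟨p, q, hpq⟩ := mem_planeLattice.1 (e ⟨z, hzz⟩).2
  have e1 := he ⟨1, hone⟩
  have e2 := he ⟨z, hzz⟩
  have e3 := he (⟨1, hone⟩ + ⟨z, hzz⟩)
  rw [map_add] at e3
  push_cast at e3
  rw [hmn] at e1 e3
  rw [hpq] at e2 e3
  have r1 : (m ^ 2 * (w.re ^ 2 + w.im ^ 2) + 2 * (m * n) * w.re + n ^ 2 : ℝ) = 1 := by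
    rw [← norm_sq_comb, e1]
    simp
  have r2 : (p ^ 2 * (w.re ^ 2 + w.im ^ 2) + 2 * (p * q) * w.re + q ^ 2 : ℝ)
      = z.re ^ 2 + z.im ^ 2 := by
    rw [← norm_sq_comb, e2]
    have := norm_sq_comb z 1 0
    simpa using this
  have r3 : ((m + p) ^ 2 * (w.re ^ 2 + w.im ^ 2) + 2 * ((m + p) * (n + q)) * w.re
      + (n + q) ^ 2 : ℝ) = z.re ^ 2 + z.im ^ 2 + 2 * z.re + 1 := by
    have h1 := norm_sq_comb w (m + p) (n + q)
    have h2 := norm_sq_comb z 1 1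
    push_cast at h1 h2
    rw [← h1]
    have h3 : ((m + p) * w + (n + q) : ℂ) = m * w + n + (p * w + q) := by ring
    rw [h3, e3]
    have h4 : (1 + z : ℂ) = 1 * z + 1 := by ring
    rw [h4, h2]
    ring
  have r4 : (m * p * (w.re ^ 2 + w.im ^ 2) + (m * q + n * p) * w.re + n * q : ℝ) = z.re := by
    linarith
  have hdet : ((m * q - n * p : ℝ)) ^ 2 * w.im ^ 2 = z.im ^ 2 := by
    have : z.im ^ 2 = 1 * (z.re ^ 2 + z.im ^ 2) - z.re ^ 2 := by ring
    rw [this, ← r2, ← r4, ← r1]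
    ring
  have hzi := z.im_pos
  have hD : m * q - n * p ≠ 0 := by
    intro h
    have : (m * q - n * p : ℝ) = 0 := by exact_mod_cast h
    rw [this] at hdet
    simp at hdet
    exact (pow_pos hzi 2).ne hdet
  constructor
  · by_cases hp : p = 0
    · have hm : m ≠ 0 := by
        rintro rfl
        simp [hp] at hD
      have h1 := norm_le_norm_comb hw (n := n) hm
      rw [e1] at h1
      simp at h1
      have := hz.2.2
      linarith
    · have h1 := norm_le_norm_comb hw (n := q) hp
      rw [norm_sq_comb, r2] at h1
      exact h1
  · have : (1 : ℝ) ≤ (m * q - n * p) ^ 2 := by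
      have : (1 : ℤ) ≤ (m * q - n * p) ^ 2 := by
        have : 0 < (m * q - n * p) ^ 2 := by positivity
        omega
      exact_mod_cast this
    rw [← hdet]
    nlinarith [sq_nonneg w.im]

theorem eq_of_sameShape {z w : ℍ} (hz : z ∈ fundamentalDomain) (hw : w ∈ fundamentalDomain)
    (h : SameShape (planeLattice z) (planeLattice w)) : z = w := by
  obtain ⟨h1, h2⟩ := le_of_sameShape hz hw h
  obtain ⟨h3, h4⟩ := le_of_sameShape hw hz h.symm
  have hi : z.im = w.im :=
    (sq_eq_sq₀ z.im_pos.le w.im_pos.le).1 (le_antisymm h4 h2)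
  have hr : z.re = w.re := (sq_eq_sq₀ hz.1 hw.1).1 (by linarith)
  exact UpperHalfPlane.ext (Complex.ext hr hi)

theorem sameShape_smul (g : Matrix.SpecialLinearGroup (Fin 2) ℤ) (z : ℍ) :
    SameShape (planeLattice (g • z)) (planeLattice z) := by
  set d : ℂ := g 1 0 * z + g 1 1 with hd
  have hd0 : d ≠ 0 := by
    have := UpperHalfPlane.denom_ne_zero (g : Matrix.GeneralLinearGroup (Fin 2) ℝ) z
    simpa [UpperHalfPlane.denom] using this
  have hgz : d * ((g • z : ℍ) : ℂ) = g 0 0 * z + g 0 1 := by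
    rw [UpperHalfPlane.specialLinearGroup_apply]
    simp only [hd] at hd0
    simp only [hd]
    simp at hd0 ⊢
    field_simp
  have hdet : g 0 0 * g 1 1 - g 0 1 * g 1 0 = 1 := by
    rw [← Matrix.det_fin_two]
    exact g.2
  have hdetC : (g 0 0 * g 1 1 - g 0 1 * g 1 0 : ℂ) = 1 := by exact_mod_cast hdet
  have key : planeLattice z = (planeLattice (g • z)).map (AddMonoidHom.mulLeft d) := by
    ext x
    simp only [AddSubgroup.mem_map, mem_planeLattice, AddMonoidHom.coe_mulLeft]
    constructor
    · rintro ⟨m, n, rfl⟩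
      refine ⟨_, ⟨m * g 1 1 - n * g 1 0, n * g 0 0 - m * g 0 1, rfl⟩, ?_⟩
      rw [mul_add, mul_left_comm, hgz, hd]
      push_cast
      linear_combination (m * z + n : ℂ) * hdetC
    · rintro ⟨_, ⟨m, n, rfl⟩, rfl⟩
      refine ⟨m * g 0 0 + n * g 1 0, m * g 0 1 + n * g 1 1, ?_⟩
      rw [mul_add, mul_left_comm, hgz, hd]
      push_cast
      ring
  rw [key]
  exact sameShape_map _ ‖d‖ (norm_pos_iff.2 hd0) (fun x => by simp) _

theorem exists_sameShape_planeLattice (z : ℍ) :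
    ∃ w ∈ fundamentalDomain, SameShape (planeLattice w) (planeLattice z) := by
  obtain ⟨g, hg⟩ := ModularGroup.exists_smul_mem_fd z
  obtain ⟨h1, h2⟩ := hg
  have hs := sameShape_smul g z
  set w : ℍ := g • z
  rw [Complex.normSq_apply] at h1
  simp only [UpperHalfPlane.coe_re, UpperHalfPlane.coe_im] at h1
  rw [abs_le] at h2
  rcases le_total 0 w.re with h | h
  · exact ⟨w, ⟨h, h2.2, by nlinarith⟩, hs⟩
  · let v : ℍ := ⟨-(starRingEnd ℂ) w, by simpa using w.im_pos⟩
    have hvc : (v : ℂ) = -(starRingEnd ℂ) w := rfl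
    have hre : v.re = -w.re := by
      rw [← UpperHalfPlane.coe_re, hvc]; simp
    have him : v.im = w.im := by
      rw [← UpperHalfPlane.coe_im, hvc]; simp
    refine ⟨v, ⟨by linarith, by linarith, by rw [hre, him]; nlinarith⟩, SameShape.trans ?_ hs⟩
    let f : ℂ →+ ℂ := -(starRingEnd ℂ : ℂ →+* ℂ).toAddMonoidHom
    have hf : ∀ x, f x = -(starRingEnd ℂ) x := fun x => rfl
    have key : planeLattice w = (planeLattice v).map f := by
      ext x
      simp only [AddSubgroup.mem_map, mem_planeLattice]
      constructor
      · rintro ⟨m, n, rfl⟩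
        exact ⟨_, ⟨m, -n, rfl⟩, by rw [hf, hvc]; simp; ring⟩
      · rintro ⟨_, ⟨m, n, rfl⟩, rfl⟩
        exact ⟨m, -n, by rw [hf, hvc]; simp; ring⟩
    rw [key]
    exact sameShape_map f 1 one_pos (fun x => by simp [hf]) _

/-- A lattice of rank two has the shape of `ℤ + ℤ z` for exactly one `z` in the fundamental
domain. -/
theorem existsUnique_sameShape {V : Type*} [NormedAddCommGroup V] [InnerProductSpace ℝ V]
    (u v : V) (huv : LinearIndependent ℝ ![u, v]) :
    ∃! z : ℍ, z ∈ fundamentalDomain ∧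
      SameShape (planeLattice z) (AddSubgroup.closure {u, v}) := by
  apply existsUnique_of_exists_of_unique
  · have hu : u ≠ 0 := huv.ne_zero 0
    have hu2 : 0 < ‖u‖ := norm_pos_iff.2 hu
    set r : ℝ := inner ℝ u v / ‖u‖ ^ 2 with hr
    set n : V := v - r • u with hn
    have hn0 : n ≠ 0 := by
      intro h
      rw [LinearIndependent.pair_iff] at huv
      have := huv (-r) 1 (by rw [← h, hn]; module)
      exact one_ne_zero this.2
    have hn2 : 0 < ‖n‖ := norm_pos_iff.2 hn0
    have horth : inner ℝ u n = 0 := by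
      rw [hn, inner_sub_right, inner_smul_right, real_inner_self_eq_norm_sq, hr]
      field_simp
      ring
    let z : ℍ := ⟨⟨r, ‖n‖ / ‖u‖⟩, by show 0 < ‖n‖ / ‖u‖; positivity⟩
    have hzc : (z : ℂ) = ⟨r, ‖n‖ / ‖u‖⟩ := rfl
    let f : ℂ →+ V :=
      { toFun := fun x => x.re • u + (x.im * (‖u‖ / ‖n‖)) • n
        map_zero' := by simp
        map_add' := fun x y => by simp; module }
    have hf : ∀ x, f x = x.re • u + (x.im * (‖u‖ / ‖n‖)) • n := fun x => rfl
    have hnorm : ∀ x, ‖f x‖ = ‖u‖ * ‖x‖ := by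
      intro x
      rw [← sq_eq_sq₀ (norm_nonneg _) (by positivity), hf, mul_pow, Complex.sq_norm,
        Complex.normSq_apply, @norm_add_sq_real, norm_smul, norm_smul, inner_smul_left,
        inner_smul_right, horth]
      simp only [Real.norm_eq_abs, mul_pow, sq_abs, mul_zero]
      field_simp
      ring
    have h1 : f 1 = u := by simp [hf]
    have h2 : f z = v := by
      rw [hf, hzc]
      have : ‖n‖ / ‖u‖ * (‖u‖ / ‖n‖) = 1 := by field_simp
      simp only [this, one_smul]
      rw [hn, add_sub_cancel]
    have key : AddSubgroup.closure {u, v} = (planeLattice z).map f := by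
      rw [planeLattice, AddMonoidHom.map_closure, Set.image_pair, h1, h2]
    obtain ⟨w, hw, hs⟩ := exists_sameShape_planeLattice z
    refine ⟨w, hw, hs.trans ?_⟩
    rw [key]
    exact sameShape_map f _ hu2 hnorm _
  · rintro z w ⟨hz, hz'⟩ ⟨hw, hw'⟩
    exact eq_of_sameShape hz hw (hz'.trans hw'.symm)

/-- The point `p_L` exists and is unique as soon as the unit lattice has rank two. -/
theorem existsUnique_isUnitShape (L : Type*) [Field L] [NumberField L]
    (hL : Units.rank L = 2) : ∃! z : ℍ, IsUnitShape L z := by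
  let ε : Fin (Units.rank L) ≃ Fin 2 := finCongr hL
  let u : Fin 2 → (𝓞 L)ˣ := fun i => Units.fundSystem L (ε.symm i)
  let P : EuclideanSpace ℝ (InfinitePlace L) →ₗ[ℝ] Units.dirichletUnitTheorem.logSpace L :=
    { toFun := fun x w => x w.1
      map_add' := fun _ _ => rfl
      map_smul' := fun _ _ => rfl }
  have hind : LinearIndependent ℝ fun i => logEmb L (Additive.ofMul (u i)) := by
    apply LinearIndependent.of_comp P
    have := (Units.isMaxRank_fundSystem (K := L))
    exact this.comp ε.symm ε.symm.injective
  have hcl : unitLattice L = AddSubgroup.closure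
      {logEmb L (Additive.ofMul (u 0)), logEmb L (Additive.ofMul (u 1))} := by
    apply le_antisymm
    · rintro _ ⟨x, rfl⟩
      obtain ⟨⟨ζ, k⟩, hx, -⟩ := Units.exist_unique_eq_mul_prod L x.toMul
      have hx' : x.toMul = ζ * (u 0 ^ k (ε.symm 0) * u 1 ^ k (ε.symm 1)) := by
        rw [hx, ← Fin.prod_univ_two (fun i => u i ^ k (ε.symm i))]
        congr 1
        exact (Equiv.prod_comp ε.symm _).symm
      have hζ : logEmb L (Additive.ofMul (ζ : (𝓞 L)ˣ)) = 0 := by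
        ext w
        have := (Units.mem_torsion L).1 ζ.2 w
        simp [logEmb, this]
      rw [← ofMul_toMul x, hx', ofMul_mul, ofMul_mul, map_add, map_add, hζ, zero_add, ofMul_zpow,
        ofMul_zpow, map_zsmul, map_zsmul, AddSubgroup.mem_closure_pair]
      exact ⟨_, _, rfl⟩
    · rw [AddSubgroup.closure_le]
      rintro _ (rfl | rfl)
      · exact ⟨_, rfl⟩
      · exact ⟨_, rfl⟩
  have h2 : LinearIndependent ℝ
      ![logEmb L (Additive.ofMul (u 0)), logEmb L (Additive.ofMul (u 1))] := by
    convert hind using 1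
    ext i
    fin_cases i <;> rfl
  simp only [IsUnitShape, hcl]
  exact existsUnique_sameShape _ _ h2

/-- `L` is a quartic number field with signature `(2, 1)` whose Galois closure has the dihedral
group of order `8` as its Galois group. -/
structure IsD4QuarticOfSignatureTwoOne (L : Type*) [Field L] [NumberField L] : Prop where
  finrank_eq : Module.finrank ℚ L = 4
  galois : Nonempty
    ((IntermediateField.normalClosure ℚ L (AlgebraicClosure L) ≃ₐ[ℚ] IntermediateField.normalClosure ℚ L (AlgebraicClosure L)) ≃*
      DihedralGroup 4)
  nrRealPlaces_eq : InfinitePlace.nrRealPlaces L = 2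
  nrComplexPlaces_eq : InfinitePlace.nrComplexPlaces L = 1

/-- The set of the points `p_L`, where `L` runs through the `D₄`-quartic fields of signature
`(2, 1)` that contain `K` as a subfield. -/
def shapesOver.{u} (K : Type u) [Field K] : Set ℍ :=
  {z | ∃ (L : Type u) (_ : Field L) (_ : NumberField L),
    IsD4QuarticOfSignatureTwoOne L ∧ Nonempty (K →+* L) ∧ IsUnitShape L z}

/-- The unit lattice of such a field has rank two, so that the point `p_L` is well defined. -/
theorem IsD4QuarticOfSignatureTwoOne.existsUnique_isUnitShape {L : Type*} [Field L]
    [NumberField L] (h : IsD4QuarticOfSignatureTwoOne L) : ∃! z : ℍ, IsUnitShape L z := by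
  refine UnitShape.existsUnique_isUnitShape L ?_
  rw [Units.rank, InfinitePlace.card_eq_nrRealPlaces_add_nrComplexPlaces, h.nrRealPlaces_eq,
    h.nrComplexPlaces_eq]

end UnitShape

/-! ### Finiteness of bounded lengths in unit lattices -/

namespace UnitShape

/-! A nontorsion unit of `K` gives a nonzero vector of `E_L` whose length is bounded independently
of `L`, because its absolute values at the three places of `L` are already those at places of `K`
(`exists_short_vector`). So the minimal length of `E_L` is at most some `B` depending only on `K`.

On the lower arc `1` and `z` both have minimal length, so `1 + z` corresponds to a vector of length
at most `2 * B`, and its squared length divided by the minimal one is `2 + 2 * z.re`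
(`exists_re_eq_of_sameShape`).

By Northcott's argument, lengths up to `2 * B` take only finitely many values over all `L` together:
the units involved have bounded conjugates, hence are roots of finitely many integer polynomials
(`exists_finite_norm_logEmb`). This leaves finitely many values of `z.re`, which determine `z` on
the arc (`injOn_re_lowerArc`). -/

/-- The algebraic integers of number fields of degree `n` all of whose conjugates are bounded by `B`
have only finitely many conjugates in `ℂ`, uniformly in the field. -/
theorem exists_finite_conjugates.{u} (n : ℕ) (B : ℝ) : ∃ T : Set ℂ, T.Finite ∧
    ∀ (L : Type u) [Field L] [NumberField L], Module.finrank ℚ L = n →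
      ∀ x : L, IsIntegral ℤ x → (∀ φ : L →+* ℂ, ‖φ x‖ ≤ B) → ∀ φ : L →+* ℂ, φ x ∈ T := by
  classical
  -- Bounds the elementary symmetric functions of the conjugates; `max B 1` also covers elements of
  -- degree less than `n`.
  let C := Nat.ceil (max B 1 ^ n * n.choose (n / 2))
  refine ⟨_, Polynomial.bUnion_roots_finite (algebraMap ℤ ℂ) n (Set.finite_Icc (-C : ℤ) C), ?_⟩
  intro L _ _ hn x hx hB φ
  -- Gauss's lemma: the minimal polynomial over `ℚ` has integer coefficients.
  have hmap := minpoly.isIntegrallyClosed_eq_field_fractions' ℚ hx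
  simp only [Set.mem_iUnion]
  refine ⟨minpoly ℤ x, ⟨?_, fun i => ?_⟩, ?_⟩
  · rw [← (minpoly.monic hx).natDegree_map (algebraMap ℤ ℚ), ← hmap, ← hn]
    exact minpoly.natDegree_le x
  · rw [Set.mem_Icc, ← abs_le, ← @Int.cast_le ℝ]
    refine (Eq.trans_le ?_ <| Embeddings.coeff_bdd_of_norm_le hB i).trans
      (by rw [hn]; exact Nat.le_ceil _)
    rw [hmap, Polynomial.coeff_map, eq_intCast, Int.norm_cast_rat, Int.norm_eq_abs, Int.cast_abs]
  · rw [Finset.mem_coe, Multiset.mem_toFinset, Polynomial.mem_roots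
      ((minpoly.monic hx).map _).ne_zero, Polynomial.IsRoot.def, Polynomial.eval_map,
      RingHom.ext_int (algebraMap ℤ ℂ) (φ.comp (algebraMap ℤ L)), ← Polynomial.hom_eval₂,
      ← Polynomial.aeval_def, minpoly.aeval, map_zero]

theorem logEmb_apply {L : Type*} [Field L] [NumberField L] (u : (𝓞 L)ˣ) (w : InfinitePlace L) :
    logEmb L (Additive.ofMul u) w = (w.mult : ℝ) * Real.log (w (u : L)) := rfl

theorem mult_le_two {L : Type*} [Field L] (w : InfinitePlace L) : w.mult ≤ 2 := by
  rw [InfinitePlace.mult]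
  split_ifs <;> norm_num

theorem abs_log_le_norm_logEmb {L : Type*} [Field L] [NumberField L] (u : (𝓞 L)ˣ)
    (w : InfinitePlace L) : |Real.log (w (u : L))| ≤ ‖logEmb L (Additive.ofMul u)‖ := by
  have h := PiLp.norm_apply_le (logEmb L (Additive.ofMul u)) w
  rw [logEmb_apply, Real.norm_eq_abs, abs_mul, Nat.abs_cast] at h
  have h1 : (1 : ℝ) ≤ w.mult := by exact_mod_cast InfinitePlace.mult_pos (w := w)
  nlinarith [abs_nonneg (Real.log (w (u : L)))]

/-- The lengths at most `B` that occur in unit lattices of number fields of degree `n` with `k`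
infinite places form a finite set. -/
theorem exists_finite_norm_logEmb.{u} (n k : ℕ) (B : ℝ) : ∃ S : Set ℝ, S.Finite ∧
    ∀ (L : Type u) [Field L] [NumberField L], Module.finrank ℚ L = n →
      Fintype.card (InfinitePlace L) = k → ∀ x ∈ unitLattice L, ‖x‖ ≤ B → ‖x‖ ∈ S := by
  obtain ⟨T, hT, h⟩ := exists_finite_conjugates.{u} n (Real.exp B)
  let T' : Set ℝ := Set.image2 (fun (m : ℕ) (t : ℂ) => (m : ℝ) * Real.log ‖t‖) (Set.Iic 2) T
  have hT' : T'.Finite := (Set.finite_Iic 2).image2 _ hT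
  -- The places of different fields are compared through an arbitrary numbering by `Fin k`, which is
  -- harmless since the norm is symmetric in the coordinates.
  refine ⟨(fun f : Fin k → ℝ => √(∑ i, f i ^ 2)) '' Set.univ.pi fun _ => T',
    (Set.Finite.pi fun _ => hT').image _, ?_⟩
  rintro L _ _ hn hk _ ⟨u, rfl⟩ hB
  obtain ⟨u, rfl⟩ := Additive.ofMul.surjective u
  let ε : InfinitePlace L ≃ Fin k := Fintype.equivFinOfCardEq hk
  refine ⟨fun i => logEmb L (Additive.ofMul u) (ε.symm i), fun i _ => ?_, ?_⟩
  · refine ⟨_, mult_le_two (ε.symm i), (ε.symm i).embedding (u : L), ?_, ?_⟩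
    · refine h L hn _ (RingOfIntegers.isIntegral_coe _) (fun φ => ?_) _
      have h1 := (le_abs_self _).trans ((abs_log_le_norm_logEmb u (.mk φ)).trans hB)
      rwa [Real.log_le_iff_le_exp (by simp), InfinitePlace.apply] at h1
    · simp only [InfinitePlace.norm_embedding_eq]
      rfl
  · simp only [EuclideanSpace.norm_eq, Real.norm_eq_abs, sq_abs]
    rw [Equiv.sum_comp ε.symm fun w => (logEmb L (Additive.ofMul u)) w ^ 2]

/-! ### A short vector coming from the base field -/

/-- The unit lattices of the extensions of `K` with at most `k` infinite places all contain a
nonzero vector of bounded length, provided that `K` has infinitely many units. -/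
theorem exists_short_vector.{u} (K : Type u) [Field K] [NumberField K] (hK : Units.rank K ≠ 0)
    (k : ℕ) : ∃ B : ℝ, ∀ (L : Type u) [Field L] [NumberField L] (_ : K →+* L),
      Fintype.card (InfinitePlace L) = k → ∃ x ∈ unitLattice L, x ≠ 0 ∧ ‖x‖ ≤ B := by
  obtain ⟨u, hu⟩ : ∃ u : (𝓞 K)ˣ, u ∉ Units.torsion K := by
    let i : Fin (Units.rank K) := ⟨0, Nat.pos_of_ne_zero hK⟩
    refine ⟨Units.fundSystem K i, fun h => ?_⟩
    rw [← Units.dirichletUnitTheorem.logEmbedding_eq_zero_iff, Units.logEmbedding_fundSystem] at h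
    exact (Units.basisUnitLattice K).ne_zero i (Subtype.ext h)
  obtain ⟨M, hM⟩ := (Set.finite_range fun v : InfinitePlace K => |Real.log (v (u : K))|).bddAbove
  refine ⟨√(∑ _ : Fin k, (2 * M) ^ 2), fun L _ _ f hk => ?_⟩
  let := f.toAlgebra
  have : Algebra.IsAlgebraic K L := Algebra.IsAlgebraic.tower_top (K := ℚ) K
  let U : (𝓞 L)ˣ := Units.map (RingOfIntegers.mapRingHom f).toMonoidHom u
  -- The source of uniformity: only the restriction of `w` to `K` matters.
  have hU (w : InfinitePlace L) : w (U : L) = w.comap (algebraMap K L) (u : K) := rfl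
  refine ⟨logEmb L (Additive.ofMul U), ⟨_, rfl⟩, fun h0 => hu ?_, ?_⟩
  · rw [Units.mem_torsion]
    intro v
    -- Every place of `K` extends to `L`, so a zero vector would force absolute value one at all
    -- places of `K`.
    obtain ⟨w, rfl⟩ := InfinitePlace.comap_surjective (K := L) v
    have h1 := abs_log_le_norm_logEmb U w
    rw [h0, norm_zero, abs_nonpos_iff, hU] at h1
    exact Real.eq_one_of_pos_of_log_eq_zero (InfinitePlace.pos_iff.2 (by simp)) h1
  · rw [EuclideanSpace.norm_eq]
    apply Real.sqrt_le_sqrt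
    rw [← Equiv.sum_comp (Fintype.equivFinOfCardEq hk)]
    refine Finset.sum_le_sum fun w _ => ?_
    have h1 : |Real.log (w (U : L))| ≤ M := hM ⟨w.comap (algebraMap K L), rfl⟩
    have h2 : (w.mult : ℝ) ≤ 2 := by exact_mod_cast mult_le_two w
    rw [logEmb_apply, Real.norm_eq_abs, abs_mul, Nat.abs_cast]
    gcongr

/-! ### Shapes on the lower arc -/

/-- If a lattice with shape on the lower arc contains a nonzero vector of length at most `B`, then
the real part of its shape can be read off from the lengths of vectors of length at most `2 * B`. -/
theorem exists_re_eq_of_sameShape {V : Type*} [NormedAddCommGroup V] {A : AddSubgroup V} {z : ℍ}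
    (hz : z ∈ lowerArc) (h : SameShape (planeLattice z) A) {B : ℝ} {a : V} (ha : a ∈ A)
    (ha0 : a ≠ 0) (haB : ‖a‖ ≤ B) :
    ∃ x ∈ A, ∃ y ∈ A, ‖x‖ ≤ 2 * B ∧ ‖y‖ ≤ 2 * B ∧ z.re = ‖y‖ ^ 2 / (2 * ‖x‖ ^ 2) - 1 := by
  obtain ⟨e, c, hc, he⟩ := h
  have hone : (1 : ℂ) ∈ planeLattice z := mem_planeLattice.2 ⟨0, 1, by simp⟩
  have hadd : (1 + z : ℂ) ∈ planeLattice z := mem_planeLattice.2 ⟨1, 1, by simp [add_comm]⟩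
  -- The scaling factor `c` is the minimal length of `A`, as nonzero vectors of `planeLattice z`
  -- have length at least one.
  have hcB : c ≤ B := by
    have h1 := he (e.symm ⟨a, ha⟩)
    rw [e.apply_symm_apply] at h1
    have h2 : ((e.symm ⟨a, ha⟩ : planeLattice z) : ℂ) ≠ 0 := by
      simpa [← Subtype.coe_inj] using ha0
    have h3 := one_le_norm ⟨hz.1, hz.2.1, hz.2.2.ge⟩ (e.symm ⟨a, ha⟩).2 h2
    simp only at h1
    nlinarith
  have h1 := he ⟨1, hone⟩
  have h2 := he ⟨_, hadd⟩
  have h3 : ‖(1 + z : ℂ)‖ ^ 2 = 2 + 2 * z.re := by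
    have := norm_sq_comb z 1 1
    rw [hz.2.2] at this
    push_cast at this
    rw [show (1 + z : ℂ) = 1 * z + 1 by ring, this]
    ring
  -- Crude: `z.re ≤ 1 / 2` would even give `√3`.
  have h4 : ‖(1 + z : ℂ)‖ ≤ 2 := by
    have := hz.2.1
    nlinarith [norm_nonneg (1 + z : ℂ)]
  simp only [norm_one, mul_one] at h1 h2
  -- The vectors are the images of `1` and `1 + z`; the factor `c` cancels in the quotient.
  refine ⟨_, (e ⟨1, hone⟩).2, _, (e ⟨_, hadd⟩).2, ?_, ?_, ?_⟩
  · rw [h1]; linarith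
  · rw [h2]; nlinarith
  · rw [h1, h2, mul_pow, h3]
    field_simp
    ring

theorem injOn_re_lowerArc : Set.InjOn UpperHalfPlane.re lowerArc := by
  intro z hz w hw h
  have hi : z.im = w.im := by
    rw [← sq_eq_sq₀ z.im_pos.le w.im_pos.le]
    have h1 := hz.2.2
    have h2 := hw.2.2
    rw [h] at h1
    linarith
  exact UpperHalfPlane.ext (Complex.ext h hi)

end UnitShape

theorem mainTheorem5 (K : Type*) [Field K] [NumberField K] [NumberField.IsTotallyReal K]
    (hK : Module.finrank ℚ K = 2) :
    (UnitShape.shapesOver K ∩ UnitShape.lowerArc).Finite := by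
  have hrank : Units.rank K ≠ 0 := by
    rw [Units.rank, InfinitePlace.card_eq_nrRealPlaces_add_nrComplexPlaces,
      IsTotallyReal.nrComplexPlaces_eq_zero, ← IsTotallyReal.finrank, hK]
    norm_num
  -- Signature `(2, 1)` means three infinite places.
  obtain ⟨B, hB⟩ := UnitShape.exists_short_vector K hrank 3
  obtain ⟨S, hS, h⟩ := UnitShape.exists_finite_norm_logEmb 4 3 (2 * B)
  refine Set.Finite.of_finite_image
    ((hS.image2 (fun s t => t ^ 2 / (2 * s ^ 2) - 1) hS).subset ?_)
    (UnitShape.injOn_re_lowerArc.mono Set.inter_subset_right)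
  rintro _ ⟨z, ⟨⟨L, _, _, hL, ⟨f⟩, -, hz⟩, harc⟩, rfl⟩
  have hcard : Fintype.card (InfinitePlace L) = 3 := by
    rw [InfinitePlace.card_eq_nrRealPlaces_add_nrComplexPlaces, hL.nrRealPlaces_eq,
      hL.nrComplexPlaces_eq]
  obtain ⟨a, ha, ha0, haB⟩ := hB L f hcard
  obtain ⟨x, hx, y, hy, hxB, hyB, hre⟩ := UnitShape.exists_re_eq_of_sameShape harc hz ha ha0 haB
  exact ⟨_, h L hL.finrank_eq hcard x hx hxB, _, h L hL.finrank_eq hcard y hy hyB, hre.symm⟩
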